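/- Let $f:\mathbb R\to\mathbb C$ be an infinitely divisible characteristic function of a probability distribution on $\mathbb R$ (for every positive integer $n$, $f=\varphi^n$ for some characteristic function $\varphi$), and suppose that $f$ is symmetric, i.e. $f(-t)=f(t)$ for all real $t$. Then $f(t)$ is real and positive for all $t$, and, with $x^{1/m}$ denoting the positive $m$-th root, the following hold. For every positive integer $m$ the function $f_m(t)=f(\sqrt m\,t)^{1/m}$ is a characteristic function. The limit $g(t)=\lim_{m\to\infty}f_m(t)$ exists for every real $t$, and there is $\sigma\ge 0$ such that $g(t)=\exp(-\sigma^2t^2)$ for all $t$; thus $g$ is the characteristic function of a non-degenerate centred Gaussian distribution or of the distribution degenerate at zero. Moreover, $f$ has no Gaussian component if and only if $g(t)=1$ for all $t$. Here $f$ is said to have a Gaussian component if there are independent random variables $Y_1,Y_2$ on some probability space such that $Y_1$ has a non-degenerate Gaussian distribution (with arbitrary mean) and $Y_1+Y_2$ has characteristic function $f$. -/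

import Mathlib

open MeasureTheory ProbabilityTheory Filter Topology
open scoped NNReal

/-- `f` is the characteristic function of a Borel probability measure on `ℝ`. -/
def IsCharFun (f : ℝ → ℂ) : Prop :=
  ∃ μ : Measure ℝ, IsProbabilityMeasure μ ∧ charFun μ = f

/-- `f` is an infinitely divisible characteristic function: it is a characteristic function, and
for every positive integer `n` it is the `n`-th power of a characteristic function. -/
def IsInfDivCharFun (f : ℝ → ℂ) : Prop :=
  IsCharFun f ∧ ∀ n : ℕ, 1 ≤ n → ∃ φ : ℝ → ℂ, IsCharFun φ ∧ ∀ t, f t = φ t ^ n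

/-- `f` has a Gaussian component: a random variable `X` with characteristic function `f` can be
written `X = Y₁ + Y₂` with independent random variables `Y₁`, `Y₂`, where `Y₁` has a
non-degenerate Gaussian distribution. -/
def HasGaussianComponent (f : ℝ → ℂ) : Prop :=
  ∃ (Ω : Type) (_ : MeasurableSpace Ω) (P : Measure Ω) (X Y₁ Y₂ : Ω → ℝ),
    IsProbabilityMeasure P ∧ Measurable X ∧ Measurable Y₁ ∧ Measurable Y₂ ∧
    charFun (P.map X) = f ∧ (∀ ω, X ω = Y₁ ω + Y₂ ω) ∧ IndepFun Y₁ Y₂ P ∧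
    ∃ (a : ℝ) (v : ℝ≥0), v ≠ 0 ∧ P.map Y₁ = gaussianReal a v

/-- The function `f_m(t) = f(√m t)^{1/m}`, with the principal branch of the power, which is the
positive root wherever `f` is real and positive. -/
noncomputable def rootRescaled (f : ℝ → ℂ) (m : ℕ) (t : ℝ) : ℂ :=
  f (Real.sqrt m * t) ^ ((1 : ℂ) / (m : ℂ))

/-! Everything is read off a Lévy–Khinchin representation. Infinite divisibility forbids zeros
(`two_mul_ne_zero`), so a symmetric `f` is positive and `ψ = -log f` is defined; each `exp (-ψ / n)`
is again a characteristic function (`isCharFun_root`). Compactness then gives a finite measure `G`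
with `ψ t = ∫ levyKernel t x ∂G` (`exists_levyKernel_representation`).

The atom of `G` at 0 contributes `G {0} * t² / 2` to `ψ`, a Gaussian factor. The rest of `G` gives a
limit of compound Poisson characteristic functions, so `f` is a Gaussian factor times a
characteristic function.

Under `ψ (√m t) / m` the kernel tends to 0 at every `x ≠ 0` and stays `t² / 2` at 0, so by dominated
convergence only the atom survives and `g` is the Gaussian factor. If `G {0} > 0`, this factor is a
Gaussian component. Conversely, a component of variance `v` forces `ψ t ≥ v t² / 2`, a bound
preserved by the rescaling, so `g` is not 1. -/

namespace IsCharFun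

/-! ### Closure properties of characteristic functions -/

variable {φ χ : ℝ → ℂ}

lemma continuous (h : IsCharFun φ) : Continuous φ := by
  obtain ⟨μ, _, rfl⟩ := h
  fun_prop

lemma map_zero (h : IsCharFun φ) : φ 0 = 1 := by
  obtain ⟨μ, _, rfl⟩ := h
  simp

lemma norm_le_one (h : IsCharFun φ) (t : ℝ) : ‖φ t‖ ≤ 1 := by
  obtain ⟨μ, _, rfl⟩ := h
  exact norm_charFun_le_one t

lemma map_neg (h : IsCharFun φ) (t : ℝ) : φ (-t) = starRingEnd ℂ (φ t) := by
  obtain ⟨μ, _, rfl⟩ := h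
  exact charFun_neg t

lemma one : IsCharFun (fun _ => 1) :=
  ⟨Measure.dirac 0, inferInstance, by ext t; simp [charFun_dirac]⟩

lemma mul (h : IsCharFun φ) (h' : IsCharFun χ) : IsCharFun (fun t => φ t * χ t) := by
  obtain ⟨μ, _, rfl⟩ := h
  obtain ⟨ν, _, rfl⟩ := h'
  exact ⟨μ ∗ ν, inferInstance, by ext t; exact charFun_conv t⟩

lemma pow (h : IsCharFun φ) (n : ℕ) : IsCharFun (fun t => φ t ^ n) := by
  induction n with
  | zero => simpa using one
  | succ n ih => simpa only [pow_succ] using ih.mul h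

lemma comp_mul_left (h : IsCharFun φ) (r : ℝ) : IsCharFun (fun t => φ (r * t)) := by
  obtain ⟨μ, _, rfl⟩ := h
  exact ⟨μ.map (r * ·), Measure.isProbabilityMeasure_map (by fun_prop), by
    ext t; exact charFun_map_mul r t⟩

lemma star (h : IsCharFun φ) : IsCharFun (fun t => starRingEnd ℂ (φ t)) := by
  simpa [h.map_neg] using h.comp_mul_left (-1)

lemma integrable_cexp (μ : Measure ℝ) [IsFiniteMeasure μ] (t : ℝ) :
    Integrable (fun x : ℝ => Complex.exp (t * x * Complex.I)) μ := by
  refine Integrable.of_bound (by fun_prop) 1 (ae_of_all _ fun x => ?_)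
  rw [← Complex.ofReal_mul, Complex.norm_exp_ofReal_mul_I]

lemma mixture (h : IsCharFun φ) {p : ℝ} (hp₀ : 0 ≤ p) (hp₁ : p ≤ 1) :
    IsCharFun (fun t => 1 + p * (φ t - 1)) := by
  obtain ⟨μ, _, rfl⟩ := h
  refine ⟨ENNReal.ofReal (1 - p) • Measure.dirac 0 + ENNReal.ofReal p • μ, ⟨?_⟩, ?_⟩
  · simp only [Measure.coe_add, Measure.coe_smul, Pi.add_apply, Pi.smul_apply, measure_univ,
      smul_eq_mul, mul_one]
    rw [← ENNReal.ofReal_add (by linarith) hp₀]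
    simp
  · ext t
    simp only [charFun_apply_real]
    rw [integral_add_measure ((integrable_cexp _ t).smul_measure ENNReal.ofReal_ne_top)
      ((integrable_cexp _ t).smul_measure ENNReal.ofReal_ne_top), integral_smul_measure,
      integral_smul_measure, integral_dirac, ENNReal.toReal_ofReal (by linarith),
      ENNReal.toReal_ofReal hp₀]
    simp only [Complex.real_smul]
    push_cast
    simp
    ring

/-- Lévy's continuity theorem: continuity at 0 gives tightness, and a Prokhorov limit along an
ultrafilter has the right characteristic function. -/
lemma of_tendsto {φ : ℕ → ℝ → ℂ} {χ : ℝ → ℂ} (h : ∀ n, IsCharFun (φ n))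
    (hlim : ∀ t, Tendsto (fun n => φ n t) atTop (𝓝 (χ t))) (hχ : ContinuousAt χ 0) :
    IsCharFun χ := by
  choose μ hμ hμφ using h
  obtain rfl : (fun n => charFun (μ n)) = φ := funext hμφ
  have htight := isTightMeasureSet_of_tendsto_charFun hχ hlim
  let P : ℕ → ProbabilityMeasure ℝ := fun n => ⟨μ n, hμ n⟩
  have hcompact : IsCompact (closure (Set.range P)) := by
    refine isCompact_closure_of_isTightMeasureSet (htight.subset ?_)
    rintro _ ⟨_, ⟨n, rfl⟩, rfl⟩
    exact ⟨n, rfl⟩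
  obtain ⟨Q, -, hQ⟩ := hcompact.ultrafilter_le_nhds ((hyperfilter ℕ).map P) (by
    rw [le_principal_iff]
    exact Filter.mem_map.2 (univ_mem' fun n => subset_closure ⟨n, rfl⟩))
  have hQ' : Tendsto P (hyperfilter ℕ) (𝓝 Q) := hQ
  refine ⟨Q, inferInstance, funext fun t => ?_⟩
  rw [ProbabilityMeasure.tendsto_iff_forall_integral_rclike_tendsto ℂ] at hQ'
  have h1 := hQ' (BoundedContinuousFunction.innerProbChar t)
  simp_rw [← charFun_eq_integral_innerProbChar] at h1
  exact tendsto_nhds_unique h1 ((hlim t).mono_left Nat.hyperfilter_le_atTop)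

/-- Compound Poisson law, obtained as a limit of `k`-th powers of mixtures with weight `l / k`. -/
lemma exp_mul_sub_one (h : IsCharFun φ) {l : ℝ} (hl : 0 ≤ l) :
    IsCharFun (fun t => Complex.exp (l * (φ t - 1))) := by
  obtain ⟨N, hN⟩ := exists_nat_ge l
  -- The shift by `N ≥ l` keeps the mixture weight at most 1.
  refine of_tendsto (φ := fun n t => (1 + ((l / (n + N + 1 : ℕ) : ℝ) : ℂ) * (φ t - 1)) ^ (n + N + 1))
    (fun n => (h.mixture (by positivity) ?_).pow _) (fun t => ?_) ?_
  · rw [div_le_one (by positivity)]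
    push_cast
    linarith [Nat.cast_nonneg (α := ℝ) n]
  · have := (Complex.tendsto_one_add_div_pow_exp (l * (φ t - 1))).comp (tendsto_add_atTop_nat (N + 1))
    refine this.congr fun n => ?_
    simp only [Function.comp]
    push_cast
    rw [← add_assoc n N 1, div_mul_eq_mul_div]
    congr 3
    ring
  · have := h.continuous
    fun_prop

/-- Symmetrization: the compound Poisson of rate `l / 2` times its conjugate. -/
lemma exp_mul_re_sub_one (h : IsCharFun φ) {l : ℝ} (hl : 0 ≤ l) :
    IsCharFun (fun t => (Real.exp (l * ((φ t).re - 1)) : ℂ)) := by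
  have h1 := h.exp_mul_sub_one (l := l / 2) (by positivity)
  convert h1.mul h1.star using 2 with t
  rw [← Complex.exp_conj, ← Complex.exp_add, Complex.ofReal_exp]
  congr 1
  rw [map_mul, Complex.conj_ofReal, ← mul_add, Complex.add_conj]
  push_cast
  simp
  ring

lemma re_eq_integral_cos (μ : Measure ℝ) [IsFiniteMeasure μ] (t : ℝ) :
    (charFun μ t).re = ∫ x, Real.cos (t * x) ∂μ := by
  rw [charFun_apply_real, ← RCLike.re_eq_complex_re, ← integral_re (integrable_cexp μ t)]
  refine integral_congr_ae (ae_of_all _ fun x => ?_)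
  simp only [RCLike.re_eq_complex_re, ← Complex.ofReal_mul, Complex.exp_ofReal_mul_I_re]

lemma integrable_cos (μ : Measure ℝ) [IsFiniteMeasure μ] (t : ℝ) :
    Integrable (fun x : ℝ => Real.cos (t * x)) μ :=
  Integrable.of_bound (by fun_prop) 1 (ae_of_all _ fun x => Real.abs_cos_le_one _)

/-- Integrates `1 - cos 2y = 2 (1 - cos y) (1 + cos y) ≤ 4 (1 - cos y)`. -/
lemma one_sub_re_two_mul_le (h : IsCharFun φ) (t : ℝ) :
    1 - (φ (2 * t)).re ≤ 4 * (1 - (φ t).re) := by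
  obtain ⟨μ, _, rfl⟩ := h
  rw [re_eq_integral_cos, re_eq_integral_cos]
  have h1 : ∫ x, (1 - Real.cos (2 * t * x)) ∂μ ≤ ∫ x, 4 * (1 - Real.cos (t * x)) ∂μ := by
    refine integral_mono ((integrable_const _).sub (integrable_cos μ _))
      (((integrable_const _).sub (integrable_cos μ _)).const_mul _) fun x => ?_
    have h2 : Real.cos (2 * t * x) = 2 * Real.cos (t * x) ^ 2 - 1 := by
      rw [mul_assoc, Real.cos_two_mul]
    simp only [h2]
    nlinarith [sq_nonneg (1 - Real.cos (t * x))]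
  rw [integral_const_mul, integral_sub (integrable_const _) (integrable_cos μ _),
    integral_sub (integrable_const _) (integrable_cos μ _)] at h1
  simpa using h1

end IsCharFun

/-! ### Absence of zeros and positive roots -/

namespace IsInfDivCharFun

variable {f : ℝ → ℂ}

/-- A zero at `2 * t` is a zero of every root `φ n`; the doubling inequality for `|φ n|²` then gives
`|f t|^(2/n) ≤ 3/4`, whereas the left side tends to 1 when `f t ≠ 0`. -/
lemma two_mul_ne_zero (hf : IsInfDivCharFun f) {t : ℝ} (ht : f t ≠ 0) : f (2 * t) ≠ 0 := by
  intro h0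
  choose! φ hφ hφf using hf.2
  have hF : ∀ n : ℕ, 1 ≤ n → 1 ≤ 4 * (1 - (‖f t‖ ^ 2) ^ ((1 : ℝ) / n)) := by
    intro n hn
    have h1 := ((hφ n hn).mul (hφ n hn).star).one_sub_re_two_mul_le t
    have hz : φ n (2 * t) = 0 := by
      have := hφf n hn (2 * t)
      rw [h0] at this
      exact pow_eq_zero_iff (by omega) |>.1 this.symm
    have hroot : (‖f t‖ ^ 2) ^ ((1 : ℝ) / n) = ‖φ n t‖ ^ 2 := by
      rw [hφf n hn t, norm_pow, ← pow_mul, mul_comm n 2, pow_mul, one_div,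
        Real.pow_rpow_inv_natCast (by positivity) (by omega)]
    rw [hroot]
    simp only [hz, zero_mul, Complex.zero_re, Complex.mul_conj, Complex.ofReal_re,
      Complex.normSq_eq_norm_sq, sub_zero] at h1
    exact h1
  have hlim : Tendsto (fun n : ℕ => 4 * (1 - (‖f t‖ ^ 2) ^ ((1 : ℝ) / n))) atTop (𝓝 0) := by
    have : Tendsto (fun n : ℕ => (‖f t‖ ^ 2) ^ ((1 : ℝ) / n)) atTop (𝓝 ((‖f t‖ ^ 2) ^ (0 : ℝ))) :=
      ((Real.continuousAt_const_rpow (by positivity)).tendsto).comp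
        tendsto_one_div_atTop_nhds_zero_nat
    have := (this.const_sub 1).const_mul 4
    simpa using this
  exact absurd (ge_of_tendsto hlim (eventually_atTop.2 ⟨1, hF⟩)) (by norm_num)

lemma ne_zero (hf : IsInfDivCharFun f) (t : ℝ) : f t ≠ 0 := by
  have hlim : Tendsto (fun k : ℕ => f (t / 2 ^ k)) atTop (𝓝 1) := by
    rw [← hf.1.map_zero]
    refine (hf.1.continuous.tendsto 0).comp ?_
    simpa [div_eq_mul_inv] using
      (tendsto_pow_atTop_nhds_zero_of_lt_one (r := (2⁻¹ : ℝ)) (by norm_num) (by norm_num)).const_mul t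
  obtain ⟨k, hk⟩ := (hlim.eventually_ne one_ne_zero).exists
  have key : ∀ j : ℕ, f (2 ^ j * (t / 2 ^ k)) ≠ 0 := by
    intro j
    induction j with
    | zero => simpa using hk
    | succ j ih => simpa [pow_succ', mul_assoc] using hf.two_mul_ne_zero ih
  have h1 := key k
  rwa [mul_div_cancel₀ _ (by positivity)] at h1

lemma im_eq_zero (hf : IsInfDivCharFun f) (hsymm : ∀ t, f (-t) = f t) (t : ℝ) : (f t).im = 0 := by
  have h := hf.1.map_neg t
  rw [hsymm] at h
  exact Complex.conj_eq_iff_im.1 h.symm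

lemma re_pos (hf : IsInfDivCharFun f) (hsymm : ∀ t, f (-t) = f t) (t : ℝ) : 0 < (f t).re := by
  have hne : ∀ s, (f s).re ≠ 0 := fun s h =>
    hf.ne_zero s (Complex.ext h (hf.im_eq_zero hsymm s))
  have hcont : Continuous fun s => (f s).re := Complex.continuous_re.comp hf.1.continuous
  by_contra! hle
  obtain ⟨s, hs⟩ := mem_range_of_exists_le_of_exists_ge hcont ⟨t, hle⟩
    ⟨0, by simp [hf.1.map_zero]⟩
  exact hne s hs

/-- The quotient of any characteristic `m`-th root by the positive root is continuous with values in
the finite set of `m`-th roots of unity, hence constant, and it is 1 at 0. -/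
lemma isCharFun_root (hf : IsInfDivCharFun f) (hsymm : ∀ t, f (-t) = f t) {m : ℕ} (hm : 1 ≤ m) :
    IsCharFun (fun t => (((f t).re ^ ((m : ℝ)⁻¹) : ℝ) : ℂ)) := by
  obtain ⟨φ, hφ, hφf⟩ := hf.2 m hm
  set ρ : ℝ → ℂ := fun t => (((f t).re ^ ((m : ℝ)⁻¹) : ℝ) : ℂ) with hρ
  have hpos := hf.re_pos hsymm
  have hρne : ∀ t, ρ t ≠ 0 := fun t =>
    Complex.ofReal_ne_zero.2 (Real.rpow_pos_of_pos (hpos t) _).ne'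
  have hρc : Continuous ρ := Complex.continuous_ofReal.comp <|
    (Complex.continuous_re.comp hf.1.continuous).rpow_const fun t => .inl (hpos t).ne'
  have hρm : ∀ t, ρ t ^ m = f t := fun t => by
    rw [hρ]
    simp only
    rw [← Complex.ofReal_pow, Real.rpow_inv_natCast_pow (hpos t).le (by omega)]
    exact Complex.ext rfl (hf.im_eq_zero hsymm t).symm
  have hfin : {z : ℂ | z ^ m = 1}.Finite := by
    have : {z : ℂ | z ^ m = 1} ⊆ (Polynomial.nthRootsFinset m (1 : ℂ) : Set ℂ) := fun z hz =>
      (Polynomial.mem_nthRootsFinset (by omega) _).2 hz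
    exact (Finset.finite_toSet _).subset this
  have hconst : ∀ t, φ t / ρ t = φ 0 / ρ 0 := fun t =>
    isPreconnected_univ.constant_of_mapsTo (T := {z : ℂ | z ^ m = 1}) hfin.isDiscrete
      (hφ.continuous.div hρc hρne).continuousOn
      (fun s _ => by
        change (φ s / ρ s) ^ m = 1
        rw [div_pow, ← hφf, hρm, div_self (hf.ne_zero s)]) (Set.mem_univ _) (Set.mem_univ _)
  have h0 : ρ 0 = 1 := by simp [hρ, hf.1.map_zero]
  have : ρ = φ := funext fun t => by
    have := hconst t
    rw [h0, hφ.map_zero, div_one, div_eq_one_iff_eq (hρne t)] at this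
    exact this.symm
  rwa [this]

end IsInfDivCharFun

/-! ### Lévy kernel and weighted measures -/

/-- The bounded kernel `(1 - cos (t x)) (1 + x²) / x²`, continuously extended by `t² / 2` at
`x = 0`. -/
noncomputable def levyKernel (t x : ℝ) : ℝ :=
  t ^ 2 / 2 * Real.sinc (t * x / 2) ^ 2 + (1 - Real.cos (t * x))

namespace levyKernel

lemma continuous (t : ℝ) : Continuous (levyKernel t) := by
  unfold levyKernel
  have := Real.continuous_sinc
  fun_prop

lemma zero_right (t : ℝ) : levyKernel t 0 = t ^ 2 / 2 := by simp [levyKernel]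

lemma nonneg (t x : ℝ) : 0 ≤ levyKernel t x := by
  have := Real.cos_le_one (t * x)
  unfold levyKernel
  have : 0 ≤ t ^ 2 / 2 * Real.sinc (t * x / 2) ^ 2 := by positivity
  linarith

lemma sinc_sq_le_one (y : ℝ) : Real.sinc y ^ 2 ≤ 1 :=
  (sq_le_one_iff_abs_le_one _).2 (Real.abs_sinc_le_one y)

lemma le_bound (t x : ℝ) : levyKernel t x ≤ t ^ 2 / 2 + 2 := by
  have h1 := Real.neg_one_le_cos (t * x)
  have h2 : t ^ 2 / 2 * Real.sinc (t * x / 2) ^ 2 ≤ t ^ 2 / 2 * 1 :=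
    mul_le_mul_of_nonneg_left (sinc_sq_le_one _) (by positivity)
  unfold levyKernel
  linarith

lemma norm_le_bound (t x : ℝ) : ‖levyKernel t x‖ ≤ t ^ 2 / 2 + 2 := by
  rw [Real.norm_of_nonneg (nonneg t x)]
  exact le_bound t x

lemma integrable (t : ℝ) (G : Measure ℝ) [IsFiniteMeasure G] : Integrable (levyKernel t) G :=
  Integrable.of_bound (continuous t).aestronglyMeasurable _ (ae_of_all _ (norm_le_bound t))

lemma mul_sinc (y : ℝ) : y * Real.sinc y = Real.sin y := by
  rcases eq_or_ne y 0 with rfl | hy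
  · simp
  · rw [Real.sinc_of_ne_zero hy, mul_div_cancel₀ _ hy]

lemma one_sub_cos (y : ℝ) : 1 - Real.cos y = 2 * Real.sin (y / 2) ^ 2 := by
  have h := Real.cos_two_mul (y / 2)
  have h2 := Real.sin_sq_add_cos_sq (y / 2)
  rw [mul_div_cancel₀ y two_ne_zero] at h
  linarith

lemma sq_mul (t x : ℝ) : x ^ 2 * levyKernel t x = (1 + x ^ 2) * (1 - Real.cos (t * x)) := by
  have h : x ^ 2 * (t ^ 2 / 2 * Real.sinc (t * x / 2) ^ 2) = 1 - Real.cos (t * x) := by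
    rw [one_sub_cos, ← mul_sinc]
    ring
  rw [levyKernel, mul_add, h]
  ring

lemma div_mul (t x : ℝ) : x ^ 2 / (1 + x ^ 2) * levyKernel t x = 1 - Real.cos (t * x) := by
  rw [div_mul_eq_mul_div, sq_mul, mul_div_cancel_left₀ _ (by positivity)]

lemma bound_div_mul {t x : ℝ} (hx : x ≠ 0) :
    (1 + x ^ 2) / x ^ 2 * (1 - Real.cos (t * x)) = levyKernel t x := by
  rw [div_mul_eq_mul_div, ← sq_mul, mul_div_cancel_left₀ _ (by positivity)]

end levyKernel

lemma measureReal_abs_gt_le_of_charFun {μ : Measure ℝ} [IsProbabilityMeasure μ] {r ε : ℝ}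
    (hr : 0 < r) (h : ∀ t, |t| ≤ 2 / r → ‖1 - charFun μ t‖ ≤ ε) :
    μ.real {x | r < |x|} ≤ 2 * ε := by
  refine (measureReal_abs_gt_le_integral_charFun hr).trans ?_
  have h1 : ‖∫ t in (-2 * r⁻¹)..(2 * r⁻¹), 1 - charFun μ t‖ ≤
      ε * |2 * r⁻¹ - -2 * r⁻¹| := by
    refine intervalIntegral.norm_integral_le_of_norm_le_const fun t ht => h t ?_
    have h2 : 0 < 2 * r⁻¹ := by positivity
    rw [Set.uIoc_of_le (by linarith)] at ht
    rw [abs_le, div_eq_mul_inv]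
    exact ⟨by linarith [ht.1], ht.2⟩
  have h3 : |2 * r⁻¹ - -2 * r⁻¹| = 4 * r⁻¹ := by
    rw [abs_of_nonneg] <;> ring_nf
    positivity
  rw [h3] at h1
  calc 2⁻¹ * r * _ ≤ 2⁻¹ * r * (ε * (4 * r⁻¹)) := by gcongr
    _ = 2 * ε := by field_simp; ring

lemma div_one_add_sq_le (x : ℝ) :
    x ^ 2 / (1 + x ^ 2) ≤ 5 * (1 - Real.cos x) + {x : ℝ | 1 < |x|}.indicator 1 x := by
  have hcos := Real.cos_le_one x
  by_cases hx : 1 < |x|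
  · rw [Set.indicator_of_mem (by exact hx), Pi.one_apply]
    have : x ^ 2 / (1 + x ^ 2) ≤ 1 := by
      rw [div_le_one (by positivity)]
      linarith
    linarith
  · rw [Set.indicator_of_notMem (by exact hx), add_zero]
    have h1 := Real.cos_le_one_sub_mul_cos_sq (x := x) (by linarith [Real.pi_gt_three])
    have h2 : x ^ 2 / (1 + x ^ 2) ≤ x ^ 2 := div_le_self (by positivity) (by nlinarith)
    -- The constant 5 comes from `π² ≤ 10`.
    have h3 : 1 / 5 ≤ 2 / Real.pi ^ 2 := by
      rw [div_le_div_iff₀ (by norm_num) (by positivity)]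
      nlinarith [Real.pi_lt_d2, Real.pi_pos]
    nlinarith [sq_nonneg x]

/-- The measure `c x² / (1 + x²) dμ`. -/
noncomputable def levyWeighted (μ : Measure ℝ) (c : ℝ) : Measure ℝ :=
  μ.withDensity fun x => ENNReal.ofReal (c * (x ^ 2 / (1 + x ^ 2)))

namespace levyWeighted

variable {μ : Measure ℝ} {c : ℝ}

lemma div_le_one' (x : ℝ) : x ^ 2 / (1 + x ^ 2) ≤ 1 := by
  rw [div_le_one (by positivity)]
  linarith

lemma le_smul (hc : 0 ≤ c) : levyWeighted μ c ≤ ENNReal.ofReal c • μ := by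
  rw [← withDensity_const]
  refine withDensity_mono (ae_of_all _ fun x => ENNReal.ofReal_le_ofReal ?_)
  exact mul_le_of_le_one_right hc (div_le_one' x)

lemma isFiniteMeasure [IsFiniteMeasure μ] (hc : 0 ≤ c) : IsFiniteMeasure (levyWeighted μ c) := by
  have : IsFiniteMeasure (ENNReal.ofReal c • μ) := Measure.smul_finite _ ENNReal.ofReal_ne_top
  exact isFiniteMeasure_of_le _ (le_smul hc)

lemma real_le [IsFiniteMeasure μ] (hc : 0 ≤ c) (s : Set ℝ) :
    (levyWeighted μ c).real s ≤ c * μ.real s := by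
  have h1 := ENNReal.toReal_mono (by
    simpa using ENNReal.mul_ne_top ENNReal.ofReal_ne_top (measure_ne_top μ s)) (le_smul (μ := μ) hc s)
  simpa [ENNReal.toReal_ofReal hc, Measure.real] using h1

lemma integral_eq (hc : 0 ≤ c) (g : ℝ → ℝ) :
    ∫ x, g x ∂levyWeighted μ c = ∫ x, c * (x ^ 2 / (1 + x ^ 2)) * g x ∂μ := by
  rw [levyWeighted, integral_withDensity_eq_integral_toReal_smul (by fun_prop)
    (ae_of_all _ fun x => ENNReal.ofReal_lt_top)]
  refine integral_congr_ae (ae_of_all _ fun x => ?_)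
  simp only [smul_eq_mul]
  rw [ENNReal.toReal_ofReal (by positivity)]

lemma integral_levyKernel [IsProbabilityMeasure μ] (hc : 0 ≤ c) (t : ℝ) :
    ∫ x, levyKernel t x ∂levyWeighted μ c = c * (1 - (charFun μ t).re) := by
  rw [integral_eq hc]
  simp only [mul_assoc, levyKernel.div_mul]
  rw [integral_const_mul, integral_sub (integrable_const _) (IsCharFun.integrable_cos μ t),
    IsCharFun.re_eq_integral_cos]
  simp

/-- With `c = n` and `μ` the law of `exp (-ψ / n)`, both terms on the right stay bounded in `n`. -/
lemma real_univ_le [IsProbabilityMeasure μ] (hc : 0 ≤ c) :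
    (levyWeighted μ c).real Set.univ ≤
      5 * (c * (1 - (charFun μ 1).re)) + c * μ.real {x | 1 < |x|} := by
  have hS : MeasurableSet {x : ℝ | 1 < |x|} := measurableSet_lt (by fun_prop) (by fun_prop)
  have hcos : Integrable (fun x : ℝ => Real.cos x) μ := by
    simpa using IsCharFun.integrable_cos μ 1
  have hind : Integrable ({x : ℝ | 1 < |x|}.indicator (1 : ℝ → ℝ)) μ :=
    (integrable_const (1 : ℝ)).indicator hS
  have hint : Integrable (fun x : ℝ => 5 * (1 - Real.cos x)) μ :=
    ((integrable_const _).sub hcos).const_mul _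
  have h1 : (levyWeighted μ c).real Set.univ = c * ∫ x, x ^ 2 / (1 + x ^ 2) ∂μ := by
    have := integral_eq (μ := μ) hc (fun _ => 1)
    simpa [integral_const_mul] using this
  have h2 : ∫ x, x ^ 2 / (1 + x ^ 2) ∂μ ≤
      ∫ x, (5 * (1 - Real.cos x) + {x : ℝ | 1 < |x|}.indicator 1 x) ∂μ := by
    refine integral_mono (Integrable.of_bound
      (Measurable.aestronglyMeasurable (by fun_prop)) 1 (ae_of_all _ fun x => ?_))
      (hint.add hind) div_one_add_sq_le
    rw [Real.norm_of_nonneg (by positivity)]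
    exact div_le_one' x
  rw [integral_add hint hind, integral_const_mul, integral_sub (integrable_const _) hcos,
    integral_indicator_one hS] at h2
  rw [h1, IsCharFun.re_eq_integral_cos]
  simp only [integral_const, probReal_univ, smul_eq_mul, mul_one, one_mul] at h2 ⊢
  nlinarith

end levyWeighted

/-! ### The Lévy–Khinchin representation -/

lemma mul_one_sub_exp_neg_div_le {y : ℝ} {n : ℝ} (hn : 0 < n) :
    n * (1 - Real.exp (-y / n)) ≤ y := by
  have h1 := Real.add_one_le_exp (-y / n)
  have h2 : n * (-y / n) = -y := by field_simp
  nlinarith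

lemma tendsto_mul_one_sub_exp_neg_div (y : ℝ) :
    Tendsto (fun n : ℕ => ((n + 1 : ℕ) : ℝ) * (1 - Real.exp (-y / ((n + 1 : ℕ) : ℝ)))) atTop (𝓝 y) := by
  have hd : HasDerivAt (fun s : ℝ => 1 - Real.exp (-y * s)) y 0 := by
    have h1 : HasDerivAt (fun s : ℝ => -y * s) (-y) 0 := by
      simpa using (hasDerivAt_id (0 : ℝ)).const_mul (-y)
    simpa using h1.exp.const_sub 1
  have h2 := hd.tendsto_slope_zero_right
  have h3 : Tendsto (fun n : ℕ => (((n + 1 : ℕ) : ℝ))⁻¹) atTop (𝓝[>] 0) :=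
    (tendsto_inv_atTop_nhdsGT_zero.comp tendsto_natCast_atTop_atTop).comp (tendsto_add_atTop_nat 1)
  refine (h2.comp h3).congr fun n => ?_
  simp [div_eq_mul_inv]

/-- A Lévy–Khinchin representation for real characteristic exponents. -/
theorem exists_levyKernel_representation {ψ : ℝ → ℝ} (hψ : Continuous ψ) (hψ₀ : ψ 0 = 0)
    (hψ' : ∀ t, 0 ≤ ψ t)
    (h : ∀ n : ℕ, 1 ≤ n → IsCharFun (fun t => (Real.exp (-ψ t / n) : ℂ))) :
    ∃ G : Measure ℝ, IsFiniteMeasure G ∧ ∀ t, ψ t = ∫ x, levyKernel t x ∂G := by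
  have h' : ∀ n : ℕ, ∃ μ : Measure ℝ, IsProbabilityMeasure μ ∧
      charFun μ = (fun t => (Real.exp (-ψ t / ((n + 1 : ℕ) : ℝ)) : ℂ)) := fun n => h (n + 1) (by omega)
  choose μ hμ hμψ using h'
  have hc : ∀ n : ℕ, (0 : ℝ) ≤ ((n + 1 : ℕ) : ℝ) := fun n => Nat.cast_nonneg _
  have hc' : ∀ n : ℕ, (0 : ℝ) < ((n + 1 : ℕ) : ℝ) := fun n => Nat.cast_pos.2 (by omega)
  -- Against `levyKernel t` these integrate to `n (1 - exp (-ψ t / n))` (with `n + 1` for `n`),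
  -- which tends to `ψ t`.
  let G : ℕ → FiniteMeasure ℝ := fun n =>
    ⟨levyWeighted (μ n) ((n + 1 : ℕ) : ℝ), levyWeighted.isFiniteMeasure (hc n)⟩
  have hre : ∀ n t, (charFun (μ n) t).re = Real.exp (-ψ t / ((n + 1 : ℕ) : ℝ)) := fun n t => by
    rw [hμψ, Complex.ofReal_re]
  have hnorm : ∀ n t, ‖1 - charFun (μ n) t‖ ≤ ψ t / ((n + 1 : ℕ) : ℝ) := fun n t => by
    have h1 : Real.exp (-ψ t / ((n + 1 : ℕ) : ℝ)) ≤ 1 :=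
      Real.exp_le_one_iff.2 (div_nonpos_of_nonpos_of_nonneg (by linarith [hψ' t]) (hc n))
    rw [hμψ, ← Complex.ofReal_one, ← Complex.ofReal_sub, Complex.norm_real,
      Real.norm_of_nonneg (by linarith), le_div_iff₀ (hc' n), mul_comm]
    exact mul_one_sub_exp_neg_div_le (hc' n)
  -- The factor `n + 1` cancels against `1 - charFun ≤ ψ / (n + 1)`, so smallness of `ψ` near 0
  -- controls the tails uniformly in `n`.
  have htail : ∀ {r ε : ℝ}, 0 < r → (∀ t, |t| ≤ 2 / r → ψ t ≤ ε) → ∀ n : ℕ,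
      ((n + 1 : ℕ) : ℝ) * (μ n).real {x | r < |x|} ≤ 2 * ε := by
    intro r ε hr hε n
    have h1 := measureReal_abs_gt_le_of_charFun (μ := μ n) (ε := ε / ((n + 1 : ℕ) : ℝ)) hr
      fun t ht => (hnorm n t).trans (div_le_div_of_nonneg_right (hε t ht) (hc n))
    calc _ ≤ ((n + 1 : ℕ) : ℝ) * (2 * (ε / ((n + 1 : ℕ) : ℝ))) := mul_le_mul_of_nonneg_left h1 (hc n)
      _ = 2 * ε := by field_simp [(hc' n).ne']
  obtain ⟨B, hB⟩ : ∃ B, ∀ t, |t| ≤ 2 / 1 → ψ t ≤ B := by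
    obtain ⟨B, hB⟩ := (isCompact_Icc (a := (-2 : ℝ)) (b := 2)).bddAbove_image hψ.continuousOn
    refine ⟨B, fun t ht => hB ⟨t, ?_, rfl⟩⟩
    rw [div_one] at ht
    exact abs_le.1 ht
  have hr : ∀ j : ℕ, ∃ r : ℝ, 0 < r ∧ ∀ t, |t| ≤ 2 / r → ψ t ≤ 1 / ((j : ℝ) + 1) := by
    intro j
    have hev : ∀ᶠ t in 𝓝 (0 : ℝ), ψ t < 1 / ((j : ℝ) + 1) :=
      hψ.continuousAt.eventually_lt_const (by rw [hψ₀]; positivity)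
    obtain ⟨δ, hδ, hball⟩ := Metric.eventually_nhds_iff.1 hev
    refine ⟨4 / δ, by positivity, fun t ht => (hball ?_).le⟩
    rw [Real.dist_0_eq_abs]
    refine ht.trans_lt ?_
    rw [div_div_eq_mul_div, div_lt_iff₀ (by norm_num)]
    linarith
  choose r hr₀ hr using hr
  have hB₀ : 0 ≤ B := (hψ' 0).trans (hB 0 (by norm_num))
  let C : ℝ≥0 := ⟨5 * ψ 1 + 2 * B, by have := hψ' 1; positivity⟩
  let u : ℕ → ℝ≥0 := fun j => ⟨2 * (1 / ((j : ℝ) + 1)), by positivity⟩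
  have hu : Tendsto u atTop (𝓝 0) := by
    rw [← NNReal.tendsto_coe]
    change Tendsto (fun j : ℕ => 2 * (1 / ((j : ℝ) + 1))) atTop (𝓝 0)
    simpa using (tendsto_one_div_add_atTop_nhds_zero_nat (𝕜 := ℝ)).const_mul 2
  have hcompact := isCompact_setOfPred_finiteMeasure_mass_le_compl_isCompact_le (E := ℝ) C hu
    (K := fun j => Metric.closedBall 0 (r j)) (fun j => isCompact_closedBall _ _)
    (.inl inferInstance)
  have hmem : ∀ n, G n ∈ {ν : FiniteMeasure ℝ | ν.mass ≤ C ∧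
      ∀ j, ν (Metric.closedBall 0 (r j))ᶜ ≤ u j} := by
    intro n
    constructor
    · rw [← NNReal.coe_le_coe]
      have h1 := levyWeighted.real_univ_le (μ := μ n) (hc n)
      rw [hre] at h1
      have h2 := htail one_pos hB n
      have h3 := mul_one_sub_exp_neg_div_le (y := ψ 1) (hc' n)
      change (levyWeighted (μ n) ((n + 1 : ℕ) : ℝ)).real Set.univ ≤ 5 * ψ 1 + 2 * B
      linarith
    · intro j
      rw [← NNReal.coe_le_coe]
      change (levyWeighted (μ n) ((n + 1 : ℕ) : ℝ)).real (Metric.closedBall 0 (r j))ᶜ ≤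
        2 * (1 / ((j : ℝ) + 1))
      have hset : (Metric.closedBall (0 : ℝ) (r j))ᶜ = {x | r j < |x|} := by
        ext x
        simp
      rw [hset]
      exact (levyWeighted.real_le (hc n) _).trans (htail (hr₀ j) (hr j) n)
  obtain ⟨G', -, hG⟩ := hcompact.ultrafilter_le_nhds ((hyperfilter ℕ).map G) (by
    rw [le_principal_iff]
    exact Filter.mem_map.2 (univ_mem' hmem))
  have hG' : Tendsto G (hyperfilter ℕ) (𝓝 G') := hG
  refine ⟨G', inferInstance, fun t => ?_⟩
  rw [FiniteMeasure.tendsto_iff_forall_integral_tendsto] at hG'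
  have h1 := hG' (BoundedContinuousFunction.ofNormedAddCommGroup (levyKernel t)
    (levyKernel.continuous t) _ (levyKernel.norm_le_bound t))
  refine tendsto_nhds_unique (Tendsto.congr (fun n => ?_)
    ((tendsto_mul_one_sub_exp_neg_div (ψ t)).mono_left Nat.hyperfilter_le_atTop)) h1
  change _ = ∫ x, levyKernel t x ∂levyWeighted (μ n) ((n + 1 : ℕ) : ℝ)
  rw [levyWeighted.integral_levyKernel (hc n), hre]

/-! ### The non-Gaussian factor -/

/-- The characteristic function of a symmetrized compound Poisson distribution. -/
lemma IsCharFun.exp_neg_integral_one_sub_cos (ν : Measure ℝ) [IsFiniteMeasure ν] :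
    IsCharFun (fun t => (Real.exp (-∫ x, (1 - Real.cos (t * x)) ∂ν) : ℂ)) := by
  rcases eq_or_ne ν 0 with rfl | hν
  · simpa using IsCharFun.one
  have : NeZero ν := ⟨hν⟩
  have hpos : 0 < ν.real Set.univ := measureReal_univ_pos
  have h : IsCharFun (charFun ((ν Set.univ)⁻¹ • ν)) := ⟨_, isProbabilityMeasureSMul, rfl⟩
  convert h.exp_mul_re_sub_one hpos.le using 4 with t
  rw [IsCharFun.re_eq_integral_cos, integral_smul_measure,
    integral_sub (integrable_const _) (IsCharFun.integrable_cos ν t), ENNReal.toReal_inv]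
  change _ = ν.real Set.univ * ((ν.real Set.univ)⁻¹ • _ - 1)
  rw [smul_eq_mul, mul_sub, mul_inv_cancel_left₀ hpos.ne']
  simp

/-- Away from 0 the density `(1 + x²) / x²` is bounded, so it turns `G` into a finite jump measure
of a compound Poisson law. -/
lemma IsCharFun.exp_neg_setIntegral_levyKernel (G : Measure ℝ) [IsFiniteMeasure G] {δ : ℝ}
    (hδ : 0 < δ) :
    IsCharFun (fun t => (Real.exp (-∫ x in {x | δ < |x|}, levyKernel t x ∂G) : ℂ)) := by
  have hS : MeasurableSet {x : ℝ | δ < |x|} := measurableSet_lt (by fun_prop) (by fun_prop)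
  set ν := (G.restrict {x | δ < |x|}).withDensity
    fun x => ENNReal.ofReal ((1 + x ^ 2) / x ^ 2) with hν
  have : IsFiniteMeasure ν := by
    have hle : ν ≤ ENNReal.ofReal (1 + 1 / δ ^ 2) • G.restrict {x | δ < |x|} := by
      rw [← withDensity_const]
      refine withDensity_mono ((ae_restrict_iff' hS).2 (ae_of_all _ fun x hx => ?_))
      refine ENNReal.ofReal_le_ofReal ?_
      have h1 : δ ^ 2 < x ^ 2 := by
        rw [← sq_abs x]
        exact pow_lt_pow_left₀ hx hδ.le two_ne_zero
      have h2 : 0 < x ^ 2 := (by positivity : 0 < δ ^ 2).trans h1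
      rw [add_div, div_self h2.ne', add_comm]
      gcongr
    have : IsFiniteMeasure (ENNReal.ofReal (1 + 1 / δ ^ 2) • G.restrict {x | δ < |x|}) :=
      Measure.smul_finite _ ENNReal.ofReal_ne_top
    exact isFiniteMeasure_of_le _ hle
  convert IsCharFun.exp_neg_integral_one_sub_cos ν using 5 with t
  rw [hν, integral_withDensity_eq_integral_toReal_smul (by fun_prop)
    (ae_of_all _ fun x => ENNReal.ofReal_lt_top)]
  refine setIntegral_congr_fun hS fun x hx => ?_
  have hx0 : x ≠ 0 := by
    rintro rfl
    simp only [Set.mem_ofPred_eq, abs_zero] at hx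
    linarith
  simp only [smul_eq_mul]
  rw [ENNReal.toReal_ofReal (by positivity), levyKernel.bound_div_mul hx0]

lemma integral_levyKernel_eq (G : Measure ℝ) [IsFiniteMeasure G] (t : ℝ) :
    ∫ x, levyKernel t x ∂G =
      G.real {0} * (t ^ 2 / 2) + ∫ x in {0}ᶜ, levyKernel t x ∂G := by
  rw [← integral_add_compl (measurableSet_singleton 0) (levyKernel.integrable t G),
    integral_singleton, levyKernel.zero_right, smul_eq_mul]

/-- Supplies the continuity at 0 needed to let the truncation `δ` tend to 0. -/
lemma continuous_integral_levyKernel_of_eq {G : Measure ℝ} [IsFiniteMeasure G] {ψ : ℝ → ℝ}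
    (hψ : Continuous ψ) (h : ∀ t, ψ t = ∫ x, levyKernel t x ∂G) :
    Continuous fun t => ∫ x in {0}ᶜ, levyKernel t x ∂G := by
  have : (fun t => ∫ x in {0}ᶜ, levyKernel t x ∂G) =
      fun t => ψ t - G.real {0} * (t ^ 2 / 2) := by
    ext t
    rw [h, integral_levyKernel_eq G]
    ring
  rw [this]
  fun_prop

lemma IsCharFun.exp_neg_compl_integral_levyKernel {G : Measure ℝ} [IsFiniteMeasure G] {ψ : ℝ → ℝ}
    (hψ : Continuous ψ) (h : ∀ t, ψ t = ∫ x, levyKernel t x ∂G) :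
    IsCharFun (fun t => (Real.exp (-∫ x in {0}ᶜ, levyKernel t x ∂G) : ℂ)) := by
  have hcont := continuous_integral_levyKernel_of_eq hψ h
  refine IsCharFun.of_tendsto (fun n : ℕ => IsCharFun.exp_neg_setIntegral_levyKernel G
    (δ := 1 / ((n : ℝ) + 1)) (by positivity)) (fun t => ?_) ?_
  · have hmono : Monotone fun n : ℕ => {x : ℝ | 1 / ((n : ℝ) + 1) < |x|} := fun m n hmn x hx =>
      (one_div_le_one_div_of_le (by positivity) (by gcongr)).trans_lt
        (show 1 / ((m : ℝ) + 1) < |x| from hx)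
    have hunion : ⋃ n : ℕ, {x : ℝ | 1 / ((n : ℝ) + 1) < |x|} = {0}ᶜ := by
      ext x
      simp only [Set.mem_iUnion, Set.mem_ofPred_eq, Set.mem_compl_iff, Set.mem_singleton_iff]
      constructor
      · rintro ⟨n, hn⟩ rfl
        rw [abs_zero] at hn
        exact absurd hn (not_lt.2 (by positivity))
      · exact fun hx => exists_nat_one_div_lt (abs_pos.2 hx)
    have h1 := tendsto_setIntegral_of_monotone (f := levyKernel t) (μ := G)
      (fun n : ℕ => measurableSet_lt measurable_const (by fun_prop)) hmono
      (levyKernel.integrable t G).integrableOn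
    rw [hunion] at h1
    exact (Complex.continuous_ofReal.tendsto _).comp ((Real.continuous_exp.tendsto _).comp h1.neg)
  · exact (Complex.continuous_ofReal.comp (Real.continuous_exp.comp hcont.neg)).continuousAt

/-! ### Rescaling limit -/

lemma Real.tendsto_sinc_atTop_mul {c : ℝ} (hc : c ≠ 0) {s : ℕ → ℝ} (hs : Tendsto s atTop atTop) :
    Tendsto (fun n => Real.sinc (s n * c)) atTop (𝓝 0) := by
  have h1 : Tendsto (fun n => (|s n * c|)⁻¹) atTop (𝓝 0) := by
    refine tendsto_inv_atTop_zero.comp ?_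
    simp only [abs_mul]
    exact (tendsto_abs_atTop_atTop.comp hs).atTop_mul_const (abs_pos.2 hc)
  refine squeeze_zero_norm' ?_ h1
  filter_upwards [hs.eventually_gt_atTop 0] with n hn
  rw [Real.sinc_of_ne_zero (mul_ne_zero hn.ne' hc), Real.norm_eq_abs, abs_div, ← one_div]
  gcongr
  exact Real.abs_sin_le_one _

lemma levyKernel.tendsto_sqrt_mul_div (t x : ℝ) :
    Tendsto (fun m : ℕ => levyKernel (Real.sqrt m * t) x / m) atTop
      (𝓝 (({0} : Set ℝ).indicator (fun _ => t ^ 2 / 2) x)) := by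
  have heq : ∀ᶠ m : ℕ in atTop, levyKernel (Real.sqrt m * t) x / m =
      t ^ 2 / 2 * Real.sinc (Real.sqrt m * (t * x / 2)) ^ 2 +
        (1 - Real.cos (Real.sqrt m * t * x)) * (m : ℝ)⁻¹ := by
    filter_upwards [eventually_gt_atTop 0] with m hm
    have hm' : (m : ℝ) ≠ 0 := by positivity
    have h1 : Real.sqrt m * t * x / 2 = Real.sqrt m * (t * x / 2) := by ring
    rw [levyKernel, mul_pow, Real.sq_sqrt (Nat.cast_nonneg m), h1]
    field_simp
  refine Tendsto.congr' (EventuallyEq.symm heq) ?_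
  have h2 : Tendsto (fun m : ℕ => (1 - Real.cos (Real.sqrt m * t * x)) * (m : ℝ)⁻¹) atTop
      (𝓝 0) := by
    refine squeeze_zero (fun m => mul_nonneg (by linarith [Real.cos_le_one (Real.sqrt m * t * x)])
      (by positivity)) (fun m => ?_) (by
        simpa using (tendsto_inv_atTop_nhds_zero_nat (𝕜 := ℝ)).const_mul 2)
    exact mul_le_mul_of_nonneg_right (by linarith [Real.neg_one_le_cos (Real.sqrt m * t * x)])
      (by positivity)
  have hsqrt : Tendsto (fun m : ℕ => Real.sqrt m) atTop atTop :=
    Real.tendsto_sqrt_atTop.comp tendsto_natCast_atTop_atTop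
  rcases eq_or_ne x 0 with rfl | hx
  · simp
  rcases eq_or_ne t 0 with rfl | ht
  · simp
  · have h3 := Real.tendsto_sinc_atTop_mul (c := t * x / 2) (by positivity) hsqrt
    simpa [hx] using ((h3.pow 2).const_mul (t ^ 2 / 2)).add h2

lemma tendsto_integral_levyKernel_sqrt_mul_div (G : Measure ℝ) [IsFiniteMeasure G] (t : ℝ) :
    Tendsto (fun m : ℕ => (∫ x, levyKernel (Real.sqrt m * t) x ∂G) / m) atTop
      (𝓝 (G.real {0} * (t ^ 2 / 2))) := by
  have hlim : ∫ x, ({0} : Set ℝ).indicator (fun _ => t ^ 2 / 2) x ∂G =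
      G.real {0} * (t ^ 2 / 2) := by
    rw [integral_indicator_const _ (measurableSet_singleton 0), smul_eq_mul]
  rw [← hlim]
  simp only [← integral_div]
  refine tendsto_integral_filter_of_dominated_convergence (fun _ => t ^ 2 / 2 + 2)
    (Eventually.of_forall fun m =>
      ((levyKernel.continuous _).div_const _).aestronglyMeasurable) ?_ (integrable_const _)
    (ae_of_all _ (levyKernel.tendsto_sqrt_mul_div t))
  filter_upwards [eventually_ge_atTop 1] with m hm
  refine ae_of_all _ fun x => ?_
  have hm' : (1 : ℝ) ≤ m := by exact_mod_cast hm
  have h1 := levyKernel.norm_le_bound (Real.sqrt m * t) x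
  rw [mul_pow, Real.sq_sqrt (Nat.cast_nonneg m)] at h1
  rw [norm_div, Real.norm_natCast, div_le_iff₀ (by positivity)]
  nlinarith

/-! ### Gaussian components and conclusion -/

/-- Multiplying a characteristic function by that of a non-degenerate Gaussian law produces a
Gaussian component. -/
lemma hasGaussianComponent_of_eq_mul {f χ : ℝ → ℂ} (hχ : IsCharFun χ) {a : ℝ} {v : ℝ≥0}
    (hv : v ≠ 0) (h : ∀ t, f t = charFun (gaussianReal a v) t * χ t) : HasGaussianComponent f := by
  obtain ⟨μ, _, rfl⟩ := hχ
  refine ⟨ℝ × ℝ, inferInstance, (gaussianReal a v).prod μ, fun p => p.1 + p.2, Prod.fst, Prod.snd,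
    inferInstance, by fun_prop, measurable_fst, measurable_snd, ?_, fun _ => rfl, ?_, a, v, hv,
    measurePreserving_fst.map_eq⟩
  · rw [charFun_map_add_prod_eq_mul]
    exact (funext h).symm
  · exact indepFun_prod measurable_id measurable_id

lemma HasGaussianComponent.exists_norm_le {f : ℝ → ℂ} (h : HasGaussianComponent f) :
    ∃ v : ℝ, 0 < v ∧ ∀ t, ‖f t‖ ≤ Real.exp (-(v * t ^ 2 / 2)) := by
  obtain ⟨Ω, _, P, X, Y, Z, _, hX, hY, hZ, rfl, hXYZ, hind, a, v, hv, hgauss⟩ := h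
  refine ⟨v, by positivity, fun t => ?_⟩
  obtain rfl : X = fun ω => Y ω + Z ω := funext hXYZ
  have hZP : IsProbabilityMeasure (P.map Z) := Measure.isProbabilityMeasure_map hZ.aemeasurable
  rw [hind.charFun_map_fun_add_eq_mul hY.aemeasurable hZ.aemeasurable, hgauss, Pi.mul_apply,
    norm_mul, charFun_gaussianReal, Complex.norm_exp]
  have hre : ((t : ℂ) * a * Complex.I - v * (t : ℂ) ^ 2 / 2).re = -(v * t ^ 2 / 2) := by
    have : ((t : ℂ) * a * Complex.I - v * (t : ℂ) ^ 2 / 2) =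
        ((-(v * t ^ 2 / 2) : ℝ) : ℂ) + ((t * a : ℝ) : ℂ) * Complex.I := by
      push_cast
      ring
    rw [this, Complex.add_re, Complex.ofReal_re, Complex.re_ofReal_mul, Complex.I_re]
    ring
  rw [hre]
  exact mul_le_of_le_one_right (Real.exp_pos _).le (norm_charFun_le_one t)

lemma charFun_gaussianReal_zero (v : ℝ≥0) (t : ℝ) :
    charFun (gaussianReal 0 v) t = (Real.exp (-(v * (t ^ 2 / 2))) : ℂ) := by
  rw [charFun_gaussianReal, Complex.ofReal_exp]
  congr 1
  push_cast
  ring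

theorem theorem1 (f : ℝ → ℂ) (hf : IsInfDivCharFun f) (hsymm : ∀ t : ℝ, f (-t) = f t) :
    (∀ t : ℝ, (f t).im = 0 ∧ 0 < (f t).re) ∧
    (∀ m : ℕ, 1 ≤ m → IsCharFun (rootRescaled f m)) ∧
    ∃ g : ℝ → ℂ,
      (∀ t : ℝ, Tendsto (fun m : ℕ => rootRescaled f m t) atTop (𝓝 (g t))) ∧
      (∃ σ : ℝ, 0 ≤ σ ∧ ∀ t : ℝ, g t = ((Real.exp (-(σ ^ 2 * t ^ 2)) : ℝ) : ℂ)) ∧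
      ((∃ v : ℝ≥0, v ≠ 0 ∧ g = charFun (gaussianReal 0 v)) ∨
        g = charFun (Measure.dirac (0 : ℝ))) ∧
      (¬ HasGaussianComponent f ↔ ∀ t : ℝ, g t = 1) := by
  have him := hf.im_eq_zero hsymm
  have hre := hf.re_pos hsymm
  have hfre : ∀ t, ((f t).re : ℂ) = f t := fun t => Complex.ext rfl (him t).symm
  have hroot : ∀ (m : ℕ) (t : ℝ), rootRescaled f m t =
      (((f (Real.sqrt m * t)).re ^ ((m : ℝ)⁻¹) : ℝ) : ℂ) := fun m t => by
    rw [rootRescaled, Complex.ofReal_cpow (hre _).le, hfre]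
    push_cast
    rw [one_div]
  refine ⟨fun t => ⟨him t, hre t⟩, fun m hm => ?_, ?_⟩
  · rw [funext (hroot m)]
    exact (hf.isCharFun_root hsymm hm).comp_mul_left (Real.sqrt m)
  set ψ : ℝ → ℝ := fun t => -Real.log (f t).re with hψdef
  have hψc : Continuous ψ :=
    ((Complex.continuous_re.comp hf.1.continuous).log fun t => (hre t).ne').neg
  have hψ₀ : ψ 0 = 0 := by simp [hψdef, hf.1.map_zero]
  have hle1 : ∀ t, (f t).re ≤ 1 := fun t => (Complex.re_le_norm _).trans (hf.1.norm_le_one t)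
  have hψpos : ∀ t, 0 ≤ ψ t := fun t => neg_nonneg.2 (Real.log_nonpos (hre t).le (hle1 t))
  have hrpow : ∀ (t : ℝ) (m : ℕ), (f t).re ^ ((m : ℝ)⁻¹) = Real.exp (-(ψ t / m)) := fun t m => by
    rw [Real.rpow_def_of_pos (hre t), hψdef]
    congr 1
    ring
  have hfψ : ∀ t, f t = (Real.exp (-ψ t) : ℂ) := fun t => by
    rw [hψdef]
    simp only [neg_neg]
    rw [Real.exp_log (hre t), hfre]
  obtain ⟨G, _, hG⟩ := exists_levyKernel_representation hψc hψ₀ hψpos fun n hn => by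
    simpa only [hrpow, neg_div] using hf.isCharFun_root hsymm hn
  have hgauss : ∀ t : ℝ, charFun (gaussianReal 0 (G {0}).toNNReal) t =
      (Real.exp (-(G.real {0} * (t ^ 2 / 2))) : ℂ) := charFun_gaussianReal_zero _
  have hdecomp : ∀ t, f t = charFun (gaussianReal 0 (G {0}).toNNReal) t *
      (Real.exp (-∫ x in {0}ᶜ, levyKernel t x ∂G) : ℂ) := fun t => by
    rw [hfψ, hG, integral_levyKernel_eq, hgauss, ← Complex.ofReal_mul, ← Real.exp_add, neg_add]
  refine ⟨charFun (gaussianReal 0 (G {0}).toNNReal), fun t => ?_,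
    -- Variance `G {0}` gives exponent `-G {0} t² / 2`, so `σ² = G {0} / 2`.
    ⟨Real.sqrt (G.real {0} / 2), Real.sqrt_nonneg _, fun t => ?_⟩, ?_, ?_⟩
  · rw [hgauss]
    simp only [hroot, hrpow, hG]
    exact (Complex.continuous_ofReal.tendsto _).comp ((Real.continuous_exp.tendsto _).comp
      (tendsto_integral_levyKernel_sqrt_mul_div G t).neg)
  · rw [hgauss, Real.sq_sqrt (by positivity)]
    congr 3
    ring
  · rcases eq_or_ne (G {0}).toNNReal 0 with h0 | h0
    · right
      rw [h0, gaussianReal_zero_var]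
    · exact .inl ⟨_, h0, rfl⟩
  · constructor
    · intro hno t
      have h0 : (G {0}).toNNReal = 0 := by
        by_contra h0
        exact hno (hasGaussianComponent_of_eq_mul
          (IsCharFun.exp_neg_compl_integral_levyKernel hψc hG) h0 hdecomp)
      rw [h0, charFun_gaussianReal_zero]
      simp
    · intro hg hcomp
      obtain ⟨v, hv, hle⟩ := hcomp.exists_norm_le
      have hψv : ∀ t, v * t ^ 2 / 2 ≤ ψ t := fun t => by
        have h1 := hle t
        rw [hfψ, Complex.norm_real, Real.norm_of_nonneg (Real.exp_pos _).le, Real.exp_le_exp] at h1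
        linarith
      have hlim := tendsto_integral_levyKernel_sqrt_mul_div G 1
      have hmass : G.real {0} = 0 := by
        have h1 := hg 1
        rw [hgauss, Complex.ofReal_eq_one, Real.exp_eq_one_iff] at h1
        linarith
      rw [hmass, zero_mul] at hlim
      -- The lower bound `v t² / 2 ≤ ψ t` at `t = √m`, divided by `m`, contradicts the limit 0.
      have hge : ∀ᶠ m : ℕ in atTop, v / 2 ≤ (∫ x, levyKernel (Real.sqrt m * 1) x ∂G) / m := by
        filter_upwards [eventually_gt_atTop 0] with m hm
        have h1 := hψv (Real.sqrt m * 1)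
        rw [hG, mul_pow, Real.sq_sqrt (Nat.cast_nonneg m)] at h1
        rw [le_div_iff₀ (by positivity)]
        linarith
      linarith [ge_of_tendsto hlim hge]
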